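/- **Setting.** There are $M$ arms and a number $K\ge 1$ of clusters. A collection of means $\mu=(\mu_1,\dots,\mu_M)\in(\mathbb R^d)^M$ is a *problem instance* if there is a surjective map $c:[M]\to[K]$ (a cluster index vector) with clusters $D_k=\{m: c_m=k\}$ such that $d_{\mathrm{INTRA}}<d_{\mathrm{INTER}}$, where $$d_{\mathrm{INTER}}=\min_{p\ne q}\ \min_{i\in D_p,\,j\in D_q}\|\mu_i-\mu_j\|^2,\qquad d_{\mathrm{INTRA}}=\max_{k}\ \max_{\emptyset\ne P\subsetneq D_k}\ \min_{i\in P,\,j\in D_k\setminus P}\|\mu_i-\mu_j\|^2$$ (a minimum over the empty set is $+\infty$, a maximum over the empty set is $-\infty$). Two cluster index vectors are equivalent, $c\sim c'$, if they differ by a permutation of the labels in $[K]$. Let $\mathcal C(\mu)$ denote a cluster index vector of the clusters produced by single linkage (SLINK), which starts from $M$ singleton clusters and repeatedly merges two distinct clusters with the smallest pairwise minimum distance until $K$ clusters remain. For a problem instance $\mu$ put $$\mathrm{Alt}(\mu)=\{\lambda : \lambda \text{ is a problem instance and } \mathcal C(\lambda)\not\sim\mathcal C(\mu)\}.$$ On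 the instance $\mu$, every pull of arm $m$ yields an independent sample from the Gaussian distribution $N(\mu_m,I_d)$ on $\mathbb R^d$. An algorithm $\pi$ sequentially chooses the arm to pull, decides when to stop, and on stopping declares a cluster index vector $\hat c$; all of its decisions are measurable functions of the past observations and of an internal random seed that is independent of the samples. Let $\tau\in\{0,1,2,\dots\}\cup\{\infty\}$ be its number of pulls. It is $\delta$-PC if $\mathbb P^\pi_\mu(\tau<\infty,\ \hat c\sim\mathcal C(\mu))\ge 1-\delta$ for every problem instance $\mu$. Let $d_{kl}(a,b)$ be the Kullback–Leibler divergence between the Bernoulli distributions with means $a$ and $b$, and define $T^*(\mu)\in[0,\infty]$ by $$T^*(\mu)^{-1}=\sup_{w}\ \inf_{\lambda\in\mathrm{Alt}(\mu)}\ \frac12\sum_{m=1}^M w_m\|\lambda_m-\mu_m\|^2,$$ where $w$ ranges over the probability vectors in $\mathbb R^M$ (with $\inf\emptyset=\infty$, $1/\infty=0$, $1/0=\infty$, $0\cdot\infty=0$). **Theorem.** Let $\mu$ be a problem instance. 1. For every $\delta\in(0,\tfrac12]$ and every $\delta$-PC algorithm $\pi$, the expected number of pulls satisfies $$\mathbb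 E^\pi_\mu[\tau]\ \ge\ d_{kl}(\delta,1-\delta)\,T^*(\mu).$$ 2. For every family of algorithms $(\pi_\delta)_{0<\delta\le 1/2}$ such that $\pi_\delta$ is $\delta$-PC for each $\delta$, with numbers of pulls $\tau_\delta$, $$\liminf_{\delta\to0}\ \frac{\mathbb E^{\pi_\delta}_\mu[\tau_\delta]}{\log(1/\delta)}\ \ge\ T^*(\mu).$$ -/

import Mathlib

open MeasureTheory ProbabilityTheory Filter Topology
open scoped ENNReal

universe u

/-! ### Clusterings of the arms -/

/-- The distance `d_{i,j}(μ) = ‖μ_i - μ_j‖²` between two arms. -/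
noncomputable def armDist {M d : ℕ} (μ : Fin M → EuclideanSpace ℝ (Fin d)) (i j : Fin M) : ℝ :=
  ‖μ i - μ j‖ ^ 2

/-- The smallest distance between an arm of `A` and an arm of `B` (`+∞` if one of them is empty). -/
noncomputable def clusterDist {M d : ℕ} (μ : Fin M → EuclideanSpace ℝ (Fin d))
    (A B : Finset (Fin M)) : EReal :=
  ⨅ i ∈ A, ⨅ j ∈ B, (armDist μ i j : EReal)

/-- The `k`-th cluster `D_k = {m | c_m = k}` of a cluster index vector `c`. -/
def cluster {M K : ℕ} (c : Fin M → Fin K) (k : Fin K) : Finset (Fin M) :=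
  Finset.univ.filter fun m => c m = k

/-- The minimum inter-cluster distance `d_INTER` (`+∞` if there is only one cluster). -/
noncomputable def dInter {M K d : ℕ} (μ : Fin M → EuclideanSpace ℝ (Fin d))
    (c : Fin M → Fin K) : EReal :=
  ⨅ (p : Fin K) (q : Fin K) (_ : p ≠ q), clusterDist μ (cluster c p) (cluster c q)

/-- The maximum intra-cluster neighbour distance `d_INTRA`: the largest distance between the two
parts of a partition of a cluster into two nonempty parts (`-∞` if all clusters are singletons). -/
noncomputable def dIntra {M K d : ℕ} (μ : Fin M → EuclideanSpace ℝ (Fin d))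
    (c : Fin M → Fin K) : EReal :=
  ⨆ (k : Fin K), ⨆ P ∈ (cluster c k).powerset \ {∅, cluster c k},
    clusterDist μ P (cluster c k \ P)

/-- A collection of means is a problem instance with `K` clusters if its arms can be grouped into
`K` nonempty clusters with `d_INTRA < d_INTER`. -/
def IsInstance {M d : ℕ} (K : ℕ) (μ : Fin M → EuclideanSpace ℝ (Fin d)) : Prop :=
  ∃ c : Fin M → Fin K, Function.Surjective c ∧ dIntra μ c < dInter μ c

/-- Equivalence `c ∼ c'` of cluster index vectors: equality up to a permutation of the labels. -/
def SameClustering {M K : ℕ} (c c' : Fin M → Fin K) : Prop :=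
  ∃ σ : Equiv.Perm (Fin K), c = σ ∘ c'

/-! ### Single linkage clustering -/

/-- The collections of clusters that single linkage passes through: it starts from the
singletons, and at each iteration merges two distinct clusters with the smallest pairwise minimum
distance. -/
inductive SlinkReaches {M d : ℕ} (μ : Fin M → EuclideanSpace ℝ (Fin d)) :
    Finset (Finset (Fin M)) → Prop
  | singletons : SlinkReaches μ (Finset.univ.image fun m => {m})
  | merge (P : Finset (Finset (Fin M))) (A B : Finset (Fin M)) (hP : SlinkReaches μ P)
      (hA : A ∈ P) (hB : B ∈ P) (hAB : A ≠ B)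
      (hmin : ∀ A' ∈ P, ∀ B' ∈ P, A' ≠ B' → clusterDist μ A B ≤ clusterDist μ A' B') :
      SlinkReaches μ (insert (A ∪ B) ((P.erase A).erase B))

/-- `c` labels, by `1, …, K`, the clusters of single linkage at the moment when `K` remain. -/
def IsSlinkIndex {M K d : ℕ} (μ : Fin M → EuclideanSpace ℝ (Fin d)) (c : Fin M → Fin K) : Prop :=
  Function.Surjective c ∧ SlinkReaches μ (Finset.univ.image (cluster c))

open Classical in
/-- The cluster index vector `C(μ)` produced by single linkage. The labels are arbitrary, and so
are the clusters if ties occur (they cannot influence the result on a problem instance). -/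
noncomputable def slinkIndex {M d : ℕ} (K : ℕ) [NeZero K] (μ : Fin M → EuclideanSpace ℝ (Fin d)) :
    Fin M → Fin K :=
  if h : ∃ c : Fin M → Fin K, IsSlinkIndex μ c then h.choose else fun _ => 0

/-- The alternative instances: those with a different single linkage clustering. -/
def Alt {M d : ℕ} (K : ℕ) [NeZero K] (μ : Fin M → EuclideanSpace ℝ (Fin d)) :
    Set (Fin M → EuclideanSpace ℝ (Fin d)) :=
  {ν | IsInstance K ν ∧ ¬ SameClustering (slinkIndex K ν) (slinkIndex K μ)}

/-! ### Algorithms -/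

/-- What has been observed after `t` pulls: the arms pulled and the samples obtained. -/
abbrev History (M d t : ℕ) : Type := Fin t → Fin M × EuclideanSpace ℝ (Fin d)

/-- A sequential clustering algorithm. Every decision is a measurable function of an internal
random seed and of the observations so far: which arm to pull next, whether the run ends after `t`
pulls, and which cluster index vector to declare when it ends after `t` pulls. -/
structure BanditAlgorithm (M K d : ℕ) where
  /-- The space of the internal randomization. -/
  Seed : Type u
  [measurableSpaceSeed : MeasurableSpace Seed]
  /-- The law of the internal randomization. -/
  seedLaw : Measure Seed
  [isProbabilityMeasure_seedLaw : IsProbabilityMeasure seedLaw]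
  /-- The sampling rule. -/
  arm : (t : ℕ) → Seed × History M d t → Fin M
  /-- The stopping rule: the run ends after `t` pulls when the observations lie in this set. -/
  stopSet : (t : ℕ) → Set (Seed × History M d t)
  /-- The declaration rule. -/
  output : (t : ℕ) → Seed × History M d t → Fin M → Fin K
  measurable_arm : ∀ t, Measurable (arm t)
  measurableSet_stopSet : ∀ t, MeasurableSet (stopSet t)
  measurable_output : ∀ t, Measurable (output t)

namespace BanditAlgorithm

attribute [instance] measurableSpaceSeed isProbabilityMeasure_seedLaw

variable {M K d : ℕ} (π : BanditAlgorithm.{u} M K d)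

/-- The sample space: a seed, and for every time `t` and arm `m` the sample `X (t, m)` that arm
`m` would produce if it were pulled at time `t`. -/
abbrev Outcome : Type u := π.Seed × (ℕ × Fin M → EuclideanSpace ℝ (Fin d))

/-- The law of the outcome: all samples and the seed are independent, and every sample of arm `m`
is Gaussian with mean `μ m` and identity covariance. -/
noncomputable def law (μ : Fin M → EuclideanSpace ℝ (Fin d)) : Measure π.Outcome :=
  π.seedLaw.prod (Measure.infinitePi fun p : ℕ × Fin M =>
    multivariateGaussian (μ p.2) (1 : Matrix (Fin d) (Fin d) ℝ))

/-- The observations after `t` pulls made according to the sampling rule. -/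
def history (ω : π.Outcome) : (t : ℕ) → History M d t
  | 0 => Fin.elim0
  | t + 1 =>
    let a := π.arm t (ω.1, history ω t)
    Fin.snoc (history ω t) (a, ω.2 (t, a))

/-- The algorithm is willing to end after `t` pulls. -/
def Stops (ω : π.Outcome) (t : ℕ) : Prop := (ω.1, π.history ω t) ∈ π.stopSet t

/-- The number `τ` of pulls made before stopping (`∞` if the algorithm never stops). -/
noncomputable def stoppingTime (ω : π.Outcome) : ℝ≥0∞ :=
  ⨅ (t : ℕ) (_ : π.Stops ω t), (t : ℝ≥0∞)

/-- The event that the algorithm stops and declares `c`, up to a permutation of the labels. -/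
def declares (c : Fin M → Fin K) : Set π.Outcome :=
  {ω | ∃ t : ℕ, π.stoppingTime ω = t ∧
    SameClustering (π.output t (ω.1, π.history ω t)) c}

/-- The expected sample complexity `E[τ]` on the instance `μ`. -/
noncomputable def expectedSamples (μ : Fin M → EuclideanSpace ℝ (Fin d)) : ℝ≥0∞ :=
  ∫⁻ ω, π.stoppingTime ω ∂(π.law μ)

/-- `δ`-probably correct: on every problem instance, the algorithm declares the single linkage
clustering with probability at least `1 - δ`. -/
def IsPC [NeZero K] (δ : ℝ) : Prop :=
  ∀ μ : Fin M → EuclideanSpace ℝ (Fin d), IsInstance K μ →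
    ENNReal.ofReal (1 - δ) ≤ π.law μ (π.declares (slinkIndex K μ))

end BanditAlgorithm

/-! ### The bound -/

/-- The Kullback-Leibler divergence `d_kl(a, b)` between the Bernoulli distributions with means
`a, b ∈ [0, 1]`. -/
noncomputable def bernoulliKL (a b : ℝ) : ℝ≥0∞ :=
  InformationTheory.klDiv
    (bernoulliMeasure true false (Set.projIcc (0 : ℝ) 1 zero_le_one a))
    (bernoulliMeasure true false (Set.projIcc (0 : ℝ) 1 zero_le_one b))

/-- `T*(μ)`, defined by
`T*(μ)⁻¹ = sup_{w ∈ simplex} inf_{ν ∈ Alt(μ)} (1/2) ∑ m, w m * ‖ν m - μ m‖ ^ 2` in `[0, ∞]`. -/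
noncomputable def charTime {M d : ℕ} (K : ℕ) [NeZero K] (μ : Fin M → EuclideanSpace ℝ (Fin d)) :
    ℝ≥0∞ :=
  (⨆ w ∈ stdSimplex ℝ (Fin M), ⨅ ν ∈ Alt K μ,
    ENNReal.ofReal ((1 / 2) * ∑ m, w m * ‖ν m - μ m‖ ^ 2))⁻¹

/-! ### Gaussian likelihood ratios -/

/-! The argument is a change of measure. Fix an alternative `ν`. The event that the algorithm
declares the clustering of `μ` has probability at least `1 - δ` under `μ` and, being disjoint from
the correct declaration for `ν`, at most `δ` under `ν`. Telling `μ` from `ν` this well requires an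
expected log-likelihood ratio of at least `d_kl(δ, 1 - δ)`. By a Wald identity that expectation is
at most the sum over arms of (expected pulls) × `‖ν a - μ a‖² / 2`. Dividing by `E[τ]` turns the
expected pulls into a probability vector `w` that does not depend on `ν`, so the infimum over `ν`
and then the supremum over `w` give the bound. Single linkage enters only as the label of the
declaration.

Three lemmas carry this. `lintegral_obs_eq` is the likelihood-ratio identity at a fixed time;
cutting outcomes by the value of the stopping time extends it to the run truncated at `n`.
`integral_stoppedLLR` is the Wald identity. `le_integral_stoppedLLR` replaces data processing for KL
by `1 + x ≤ exp x`. Truncation at `n` keeps every sum finite, and `n → ∞` is taken only at the end.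
The second claim follows since `d_kl(δ, 1 - δ) ~ log (1 / δ)`. -/

theorem gaussianReal_eq_withDensity_exp (a b : ℝ) :
    gaussianReal b 1 = (gaussianReal a 1).withDensity
      fun x => ENNReal.ofReal (Real.exp ((b - a) * (x - a) - (b - a) ^ 2 / 2)) := by
  rw [gaussianReal_of_var_ne_zero _ one_ne_zero, gaussianReal_of_var_ne_zero _ one_ne_zero,
    ← withDensity_mul _ (measurable_gaussianPDF _ _) (by fun_prop)]
  congr 1
  ext x
  simp only [gaussianPDF, gaussianPDFReal, Pi.mul_apply]
  rw [← ENNReal.ofReal_mul (by positivity), mul_assoc _⁻¹, ← Real.exp_add]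
  congr 3
  push_cast
  ring

theorem lintegral_pi_prod {ι : Type*} [Fintype ι] {X : ι → Type*} [∀ i, MeasurableSpace (X i)]
    (μ : ∀ i, Measure (X i)) [∀ i, IsProbabilityMeasure (μ i)] {f : ∀ i, X i → ℝ≥0∞}
    (hf : ∀ i, Measurable (f i)) :
    ∫⁻ x, ∏ i, f i (x i) ∂Measure.pi μ = ∏ i, ∫⁻ y, f i y ∂μ i := by
  rw [lintegral_prod_eq_prod_lintegral_of_indepFun Finset.univ (fun i (x : ∀ i, X i) => f i (x i))
    (iIndepFun_pi fun i => (hf i).aemeasurable) fun i => (hf i).comp (measurable_pi_apply i)]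
  refine Finset.prod_congr rfl fun i _ => ?_
  exact (measurePreserving_eval μ i).lintegral_comp (hf i)

/-- A product measure is determined by boxes, and on a box both the indicator and the density factor
along coordinates. -/
theorem pi_withDensity_prod {ι : Type*} [Fintype ι] {X : ι → Type*} [∀ i, MeasurableSpace (X i)]
    (μ : ∀ i, Measure (X i)) [∀ i, IsProbabilityMeasure (μ i)] {f : ∀ i, X i → ℝ≥0∞}
    (hf : ∀ i, Measurable (f i)) [∀ i, SigmaFinite ((μ i).withDensity (f i))] :
    Measure.pi (fun i => (μ i).withDensity (f i)) =
      (Measure.pi μ).withDensity fun x => ∏ i, f i (x i) := by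
  refine Measure.pi_eq fun s hs => ?_
  rw [withDensity_apply _ (MeasurableSet.univ_pi hs), ← lintegral_indicator (.univ_pi hs)]
  have h : (Set.univ.pi s).indicator (fun x => ∏ i, f i (x i)) =
      fun x => ∏ i, (s i).indicator (f i) (x i) := by
    ext x
    by_cases hx : x ∈ Set.univ.pi s
    · rw [Set.indicator_of_mem hx]
      exact Finset.prod_congr rfl fun i _ => (Set.indicator_of_mem (hx i trivial) _).symm
    · rw [Set.indicator_of_notMem hx]
      obtain ⟨i, hi⟩ : ∃ i, x i ∉ s i := by simpa [Set.mem_pi] using hx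
      exact (Finset.prod_eq_zero (Finset.mem_univ i) (Set.indicator_of_notMem hi _)).symm
  rw [h, lintegral_pi_prod μ fun i => (hf i).indicator (hs i)]
  refine Finset.prod_congr rfl fun i _ => ?_
  rw [withDensity_apply _ (hs i), lintegral_indicator (hs i)]

theorem multivariateGaussian_one_eq_map_pi {ι : Type*} [Fintype ι] [DecidableEq ι]
    (μ : EuclideanSpace ℝ ι) :
    multivariateGaussian μ (1 : Matrix ι ι ℝ) =
      (Measure.pi fun i => gaussianReal (μ i) 1).map (WithLp.toLp 2) := by
  apply Measure.ext_of_charFun (E := EuclideanSpace ℝ ι)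
  ext t
  rw [charFun_multivariateGaussian Matrix.PosSemidef.one]
  simp_rw [charFun_pi, charFun_gaussianReal, ← Complex.exp_sum]
  congr 1
  simp [PiLp.inner_apply, Finset.sum_sub_distrib, Finset.mul_sum, Finset.sum_div, dotProduct, sq, mul_comm]

/-- The logarithm of the density of `N(μ, I)` with respect to `N(ν, I)`. -/
noncomputable def gaussianLLR {ι : Type*} [Fintype ι] (μ ν x : EuclideanSpace ℝ ι) : ℝ :=
  ‖ν - μ‖ ^ 2 / 2 - inner ℝ (ν - μ) (x - μ)

theorem measurable_gaussianLLR {ι : Type*} [Fintype ι] (μ ν : EuclideanSpace ℝ ι) :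
    Measurable (gaussianLLR μ ν) := by
  unfold gaussianLLR
  fun_prop

/-- With identity covariance the coordinates are independent, so the one-dimensional densities
multiply and their exponents add up to `-gaussianLLR`. -/
theorem multivariateGaussian_one_eq_withDensity {ι : Type*} [Fintype ι] [DecidableEq ι]
    (μ ν : EuclideanSpace ℝ ι) :
    multivariateGaussian ν (1 : Matrix ι ι ℝ) =
      (multivariateGaussian μ (1 : Matrix ι ι ℝ)).withDensity
        fun x => ENNReal.ofReal (Real.exp (-gaussianLLR μ ν x)) := by
  have hd : ∀ i, (gaussianReal (μ i) 1).withDensity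
      (fun x => ENNReal.ofReal (Real.exp ((ν i - μ i) * (x - μ i) - (ν i - μ i) ^ 2 / 2))) =
      gaussianReal (ν i) 1 := fun i => (gaussianReal_eq_withDensity_exp _ _).symm
  have : ∀ i, SigmaFinite ((gaussianReal (μ i) 1).withDensity
      (fun x => ENNReal.ofReal (Real.exp ((ν i - μ i) * (x - μ i) - (ν i - μ i) ^ 2 / 2)))) := by
    intro i; rw [hd]; infer_instance
  have hpi := pi_withDensity_prod (fun i => gaussianReal (μ i) 1)
    (f := fun i x => ENNReal.ofReal (Real.exp ((ν i - μ i) * (x - μ i) - (ν i - μ i) ^ 2 / 2)))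
    (fun i => by fun_prop)
  simp_rw [hd] at hpi
  have hm : Measurable fun x => ENNReal.ofReal (Real.exp (-gaussianLLR μ ν x)) :=
    (measurable_gaussianLLR μ ν).neg.exp.ennreal_ofReal
  have hL : Measurable (WithLp.toLp 2 : (ι → ℝ) → EuclideanSpace ℝ ι) := by fun_prop
  rw [multivariateGaussian_one_eq_map_pi, multivariateGaussian_one_eq_map_pi, hpi]
  ext s hs
  rw [Measure.map_apply hL hs, withDensity_apply _ (hL hs), withDensity_apply _ hs,
    setLIntegral_map hs hm hL]
  refine setLIntegral_congr_fun (hL hs) fun x _ => ?_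
  rw [← ENNReal.ofReal_prod_of_nonneg fun i _ => (Real.exp_pos _).le, ← Real.exp_sum]
  congr 2
  simp only [gaussianLLR, neg_sub, EuclideanSpace.real_norm_sq_eq, PiLp.inner_apply,
    Finset.sum_sub_distrib, Finset.sum_div]
  congr 1
  exact Finset.sum_congr rfl fun i _ => by simp [mul_comm]

theorem integrable_gaussianLLR {ι : Type*} [Fintype ι] [DecidableEq ι]
    (μ ν : EuclideanSpace ℝ ι) :
    Integrable (gaussianLLR μ ν) (multivariateGaussian μ (1 : Matrix ι ι ℝ)) := by
  unfold gaussianLLR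
  refine (integrable_const _).sub (Integrable.const_inner (𝕜 := ℝ) _ ?_)
  exact IsGaussian.integrable_fun_id.sub (integrable_const _)

/-- The linear term is centred under `N(μ, I)`; what remains is the KL divergence of the two
Gaussians. -/
theorem integral_gaussianLLR {ι : Type*} [Fintype ι] [DecidableEq ι]
    (μ ν : EuclideanSpace ℝ ι) :
    ∫ x, gaussianLLR μ ν x ∂multivariateGaussian μ (1 : Matrix ι ι ℝ) = ‖ν - μ‖ ^ 2 / 2 := by
  have hi : Integrable (fun x => x - μ) (multivariateGaussian μ (1 : Matrix ι ι ℝ)) :=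
    IsGaussian.integrable_fun_id.sub (integrable_const _)
  unfold gaussianLLR
  rw [integral_sub (integrable_const _) (hi.const_inner (𝕜 := ℝ) _), integral_inner hi,
    integral_sub IsGaussian.integrable_fun_id (integrable_const _)]
  simp

/-! ### Resampling one coordinate of a product measure -/

/-- This replaces conditioning: a function of the other coordinates does not notice the fresh draw,
so it can be integrated separately from it by Fubini. -/
theorem measurePreserving_update_infinitePi {ι : Type*} [DecidableEq ι] {X : ι → Type*}
    [∀ i, MeasurableSpace (X i)] (P : ∀ i, Measure (X i)) [∀ i, IsProbabilityMeasure (P i)]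
    (i : ι) :
    MeasurePreserving (fun p : (∀ i, X i) × X i => Function.update p.1 i p.2)
      ((Measure.infinitePi P).prod (P i)) (Measure.infinitePi P) := by
  refine ⟨measurable_update', Measure.eq_infinitePi P fun s t ht => ?_⟩
  have hbox : MeasurableSet ((s : Set ι).pi t) :=
    MeasurableSet.pi s.countable_toSet fun i _ => ht i
  rw [Measure.map_apply measurable_update' hbox]
  have hpre : (fun p : (∀ i, X i) × X i => Function.update p.1 i p.2) ⁻¹' (s : Set ι).pi t =
      ((s.erase i : Finset ι) : Set ι).pi t ×ˢ (if i ∈ s then t i else Set.univ) := by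
    ext ⟨x, z⟩
    simp only [Set.mem_preimage, Set.mem_pi, Set.mem_prod, Finset.mem_coe, Finset.mem_erase]
    constructor
    · intro h
      refine ⟨fun j hj => by simpa [hj.1] using h j hj.2, ?_⟩
      split_ifs with hi
      · simpa using h i hi
      · trivial
    · rintro ⟨h1, h2⟩ j hj
      by_cases hji : j = i
      · subst hji; simpa [hj] using h2
      · simpa [hji] using h1 j ⟨hji, hj⟩
  rw [hpre, Measure.prod_prod, Measure.infinitePi_pi P fun j _ => ht j]
  split_ifs with hi
  · exact Finset.prod_erase_mul s (fun j => P j (t j)) hi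
  · simp [Finset.erase_eq_of_notMem hi]

namespace BanditAlgorithm

variable {M K d : ℕ} (π : BanditAlgorithm.{u} M K d)

/-! ### Observations of a run -/

/-- The seed and the observations after `t` pulls. -/
def obs (t : ℕ) (ω : π.Outcome) : π.Seed × History M d t := (ω.1, π.history ω t)

/-- The arm selected at time `t`. -/
def selected (t : ℕ) (ω : π.Outcome) : Fin M := π.arm t (π.obs t ω)

theorem history_succ (ω : π.Outcome) (t : ℕ) :
    π.history ω (t + 1) = Fin.snoc (α := fun _ => Fin M × EuclideanSpace ℝ (Fin d))
      (π.history ω t) (π.selected t ω, ω.2 (t, π.selected t ω)) := rfl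

theorem history_castLE (ω : π.Outcome) {s t : ℕ} (h : s ≤ t) :
    (fun i => π.history ω t (Fin.castLE h i)) = π.history ω s := by
  induction t, h using Nat.le_induction with
  | base => rfl
  | succ t h ih =>
    rw [← ih]
    ext1 i
    rw [history_succ]
    exact Fin.snoc_castSucc (α := fun _ => Fin M × EuclideanSpace ℝ (Fin d)) _ _
      (Fin.castLE h i)

/-- The first `t` pulls read only samples with time index below `t`. -/
theorem obs_update (ω : π.Outcome) {s t : ℕ} (h : t ≤ s) (a : Fin M)
    (z : EuclideanSpace ℝ (Fin d)) :
    π.obs t (ω.1, Function.update ω.2 (s, a) z) = π.obs t ω := by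
  induction t with
  | zero => rfl
  | succ t ih =>
    have ih := ih (by omega)
    have hsel : π.selected t (ω.1, Function.update ω.2 (s, a) z) = π.selected t ω := by
      rw [selected, ih, selected]
    have hh : π.history (ω.1, Function.update ω.2 (s, a) z) t = π.history ω t :=
      congrArg Prod.snd ih
    have hne : (t, π.selected t ω) ≠ (s, a) := fun h' => by
      have := congrArg Prod.fst h'
      simp at this
      omega
    simp only [obs, history_succ, hsel, hh, Function.update_of_ne hne]

theorem measurable_obs (t : ℕ) : Measurable (π.obs t) := by
  induction t with
  | zero =>
    refine measurable_fst.prodMk ?_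
    exact measurable_pi_lambda _ fun i => i.elim0
  | succ t ih =>
    refine measurable_fst.prodMk ?_
    have hsel : Measurable (π.selected t) := (π.measurable_arm t).comp ih
    have hX : Measurable fun ω : π.Outcome => ω.2 (t, π.selected t ω) := by
      have : Measurable fun p : Fin M × π.Outcome => p.2.2 (t, p.1) :=
        measurable_from_prod_countable_right fun a =>
          (measurable_pi_apply (t, a)).comp measurable_snd
      exact this.comp (hsel.prodMk measurable_id)
    refine measurable_pi_lambda _ fun i => ?_
    simp only [history_succ]
    refine Fin.lastCases ?_ (fun j => ?_) i
    · simpa using hsel.prodMk hX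
    · simpa [Function.comp_def, obs] using
        (measurable_pi_apply j).comp (measurable_snd.comp ih)

theorem measurable_selected (t : ℕ) : Measurable (π.selected t) :=
  (π.measurable_arm t).comp (π.measurable_obs t)

/-- The algorithm has not stopped after fewer than `t` pulls. -/
def notStoppedBefore (t : ℕ) : Set π.Outcome := {ω | ∀ s < t, ¬ π.Stops ω s}

/-- The algorithm stops after exactly `t` pulls. -/
def stopsAt (t : ℕ) : Set π.Outcome := {ω | ω ∈ π.notStoppedBefore t ∧ π.Stops ω t}

/-- An event is determined by the seed and the observations after `t` pulls. -/
def IsObservable (t : ℕ) (A : Set π.Outcome) : Prop :=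
  ∃ B : Set (π.Seed × History M d t), MeasurableSet B ∧ π.obs t ⁻¹' B = A

variable {π}

theorem IsObservable.measurableSet {t : ℕ} {A : Set π.Outcome} (h : π.IsObservable t A) :
    MeasurableSet A := by
  obtain ⟨B, hB, rfl⟩ := h
  exact π.measurable_obs t hB

theorem IsObservable.inter {t : ℕ} {A A' : Set π.Outcome} (h : π.IsObservable t A)
    (h' : π.IsObservable t A') : π.IsObservable t (A ∩ A') := by
  obtain ⟨B, hB, rfl⟩ := h
  obtain ⟨B', hB', rfl⟩ := h'
  exact ⟨B ∩ B', hB.inter hB', rfl⟩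

theorem IsObservable.compl {t : ℕ} {A : Set π.Outcome} (h : π.IsObservable t A) :
    π.IsObservable t Aᶜ := by
  obtain ⟨B, hB, rfl⟩ := h
  exact ⟨Bᶜ, hB.compl, rfl⟩

theorem IsObservable.mono {s t : ℕ} (hst : s ≤ t) {A : Set π.Outcome} (h : π.IsObservable s A) :
    π.IsObservable t A := by
  obtain ⟨B, hB, rfl⟩ := h
  refine ⟨(fun p => (p.1, fun i => p.2 (Fin.castLE hst i))) ⁻¹' B, ?_, ?_⟩
  · refine Measurable.prodMk measurable_fst ?_ hB
    exact measurable_pi_lambda _ fun i => (measurable_pi_apply _).comp measurable_snd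
  · ext ω
    simp only [Set.mem_preimage, obs]
    rw [history_castLE]

variable (π)

theorem isObservable_stops (t : ℕ) : π.IsObservable t {ω | π.Stops ω t} :=
  ⟨π.stopSet t, π.measurableSet_stopSet t, rfl⟩

theorem notStoppedBefore_succ (t : ℕ) :
    π.notStoppedBefore (t + 1) = π.notStoppedBefore t ∩ {ω | π.Stops ω t}ᶜ := by
  ext ω
  simp only [notStoppedBefore, Nat.lt_succ_iff_lt_or_eq, Set.mem_ofPred_eq, Set.mem_inter_iff,
    Set.mem_compl_iff]
  constructor
  · exact fun h => ⟨fun s hs => h s (.inl hs), h t (.inr rfl)⟩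
  · rintro ⟨h1, h2⟩ s (hs | rfl)
    exacts [h1 s hs, h2]

/-- The index is `t`, not `t + 1`: whether the pull at time `t` is made is decided before its sample
is seen. The Wald identity rests on this. -/
theorem isObservable_notStoppedBefore_succ (t : ℕ) :
    π.IsObservable t (π.notStoppedBefore (t + 1)) := by
  induction t with
  | zero =>
    have : π.notStoppedBefore (0 + 1) = {ω | π.Stops ω 0}ᶜ := by
      ext ω; simp [notStoppedBefore]
    rw [this]
    exact (π.isObservable_stops 0).compl
  | succ t ih =>
    rw [notStoppedBefore_succ]
    exact (ih.mono (Nat.le_succ t)).inter (π.isObservable_stops _).compl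

theorem isObservable_notStoppedBefore (t : ℕ) : π.IsObservable t (π.notStoppedBefore t) := by
  cases t with
  | zero => exact ⟨Set.univ, .univ, by simp [notStoppedBefore]⟩
  | succ t => exact (π.isObservable_notStoppedBefore_succ t).mono (Nat.le_succ t)

theorem isObservable_stopsAt (t : ℕ) : π.IsObservable t (π.stopsAt t) :=
  (π.isObservable_notStoppedBefore t).inter (π.isObservable_stops t)

theorem isObservable_selected (t : ℕ) (a : Fin M) :
    π.IsObservable t {ω | π.selected t ω = a} :=
  ⟨π.arm t ⁻¹' {a}, π.measurable_arm t (measurableSet_singleton a), rfl⟩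

theorem stopsAt_of_stops {ω : π.Outcome} (h : ∃ t, π.Stops ω t) : ∃ t, ω ∈ π.stopsAt t := by
  classical
  exact ⟨Nat.find h, fun _ hs => Nat.find_min h hs, Nat.find_spec h⟩

theorem stoppingTime_of_stopsAt {ω : π.Outcome} {t : ℕ} (h : ω ∈ π.stopsAt t) :
    π.stoppingTime ω = t := by
  refine le_antisymm (iInf₂_le t h.2) (le_iInf₂ fun s hs => ?_)
  by_contra! hlt
  exact h.1 s (by exact_mod_cast hlt) hs

theorem stoppingTime_eq_natCast_iff {ω : π.Outcome} {t : ℕ} :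
    π.stoppingTime ω = t ↔ ω ∈ π.stopsAt t := by
  refine ⟨fun h => ?_, π.stoppingTime_of_stopsAt⟩
  by_cases hex : ∃ s, π.Stops ω s
  · obtain ⟨s, hs⟩ := π.stopsAt_of_stops hex
    have := π.stoppingTime_of_stopsAt hs
    rw [h] at this
    rwa [Nat.cast_injective this]
  · push Not at hex
    simp [stoppingTime, hex] at h

theorem mem_notStoppedBefore_iff_of_stopsAt {ω : π.Outcome} {t : ℕ} (h : ω ∈ π.stopsAt t)
    (s : ℕ) : ω ∈ π.notStoppedBefore (s + 1) ↔ s < t := by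
  constructor
  · intro hs
    by_contra! hle
    exact hs t (by omega) h.2
  · exact fun hs r hr => h.1 r (by omega)

/-- The pull at time `t` is made exactly when no stop occurs at times `0, …, t`. If no stop ever
occurs, all terms are `1` and both sides are `∞`. -/
theorem stoppingTime_eq_tsum (ω : π.Outcome) :
    π.stoppingTime ω = ∑' t, (π.notStoppedBefore (t + 1)).indicator 1 ω := by
  classical
  by_cases hex : ∃ s, π.Stops ω s
  · obtain ⟨T, hT⟩ := π.stopsAt_of_stops hex
    rw [π.stoppingTime_of_stopsAt hT, tsum_eq_sum (s := Finset.range T)]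
    · rw [Finset.sum_congr rfl fun t ht => Set.indicator_of_mem
        ((π.mem_notStoppedBefore_iff_of_stopsAt hT t).2 (Finset.mem_range.1 ht)) _]
      simp
    · intro t ht
      refine Set.indicator_of_notMem (fun h => ht ?_) _
      exact Finset.mem_range.2 ((π.mem_notStoppedBefore_iff_of_stopsAt hT t).1 h)
  · push Not at hex
    have : ∀ t, ω ∈ π.notStoppedBefore t := fun t s _ => hex s
    simp [stoppingTime, hex, this]

theorem expectedSamples_eq_tsum (μ : Fin M → EuclideanSpace ℝ (Fin d)) :
    π.expectedSamples μ = ∑' t, π.law μ (π.notStoppedBefore (t + 1)) := by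
  have hm : ∀ t, MeasurableSet (π.notStoppedBefore (t + 1)) := fun t =>
    (π.isObservable_notStoppedBefore _).measurableSet
  simp_rw [expectedSamples, stoppingTime_eq_tsum]
  rw [lintegral_tsum fun t => (measurable_one.indicator (hm t)).aemeasurable]
  simp_rw [lintegral_indicator_one (hm _)]

/-! ### Change of measure -/

instance (μ : Fin M → EuclideanSpace ℝ (Fin d)) : IsProbabilityMeasure (π.law μ) := by
  unfold law; infer_instance

theorem measurePreserving_resample (μ : Fin M → EuclideanSpace ℝ (Fin d)) (t : ℕ) (a : Fin M) :
    MeasurePreserving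
      (fun p : π.Outcome × EuclideanSpace ℝ (Fin d) =>
        ((p.1.1, Function.update p.1.2 (t, a) p.2) : π.Outcome))
      ((π.law μ).prod (multivariateGaussian (μ a) (1 : Matrix (Fin d) (Fin d) ℝ))) (π.law μ) :=
  ((MeasurePreserving.id π.seedLaw).prod (measurePreserving_update_infinitePi
    (fun p : ℕ × Fin M => multivariateGaussian (μ p.2) (1 : Matrix (Fin d) (Fin d) ℝ))
    (t, a))).comp (measurePreserving_prodAssoc _ _ _)

theorem lintegral_obs_sample (μ : Fin M → EuclideanSpace ℝ (Fin d)) (t : ℕ) (a : Fin M)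
    {F : (π.Seed × History M d t) × EuclideanSpace ℝ (Fin d) → ℝ≥0∞} (hF : Measurable F) :
    ∫⁻ ω, F (π.obs t ω, ω.2 (t, a)) ∂π.law μ =
      ∫⁻ ω, ∫⁻ z, F (π.obs t ω, z)
        ∂multivariateGaussian (μ a) (1 : Matrix (Fin d) (Fin d) ℝ) ∂π.law μ := by
  have hm : Measurable fun ω : π.Outcome => F (π.obs t ω, ω.2 (t, a)) :=
    hF.comp ((π.measurable_obs t).prodMk ((measurable_pi_apply _).comp measurable_snd))
  rw [← (π.measurePreserving_resample μ t a).lintegral_comp hm,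
    ← lintegral_prod fun p : π.Outcome × EuclideanSpace ℝ (Fin d) => F (π.obs t p.1, p.2)]
  · refine lintegral_congr fun p => ?_
    rw [π.obs_update _ le_rfl]
    simp
  · exact (hF.comp (((π.measurable_obs t).comp measurable_fst).prodMk
      measurable_snd)).aemeasurable

/-- The log-likelihood ratio of the instances `μ` and `ν` on a history. -/
noncomputable def historyLLR (μ ν : Fin M → EuclideanSpace ℝ (Fin d)) {t : ℕ}
    (h : History M d t) : ℝ :=
  ∑ s, gaussianLLR (μ (h s).1) (ν (h s).1) (h s).2

/-- The contribution of the sample obtained at time `t` to the log-likelihood ratio. -/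
noncomputable def sampleLLR (μ ν : Fin M → EuclideanSpace ℝ (Fin d)) (t : ℕ) (ω : π.Outcome) :
    ℝ :=
  gaussianLLR (μ (π.selected t ω)) (ν (π.selected t ω)) (ω.2 (t, π.selected t ω))

theorem measurable_historyLLR (μ ν : Fin M → EuclideanSpace ℝ (Fin d)) (t : ℕ) :
    Measurable (historyLLR μ ν : History M d t → ℝ) := by
  refine Finset.measurable_sum _ fun s _ => ?_
  have : Measurable fun p : Fin M × EuclideanSpace ℝ (Fin d) =>
      gaussianLLR (μ p.1) (ν p.1) p.2 :=
    measurable_from_prod_countable_right fun a => measurable_gaussianLLR (μ a) (ν a)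
  exact this.comp (measurable_pi_apply s)

theorem historyLLR_history (μ ν : Fin M → EuclideanSpace ℝ (Fin d)) (t : ℕ) (ω : π.Outcome) :
    historyLLR μ ν (π.history ω t) = ∑ s ∈ Finset.range t, π.sampleLLR μ ν s ω := by
  induction t with
  | zero => simp [historyLLR]
  | succ t ih =>
    rw [Finset.sum_range_succ, ← ih, history_succ, historyLLR, Fin.sum_univ_castSucc]
    simp [historyLLR, sampleLLR]

/-- Induction on `t`. Splitting by the selected arm makes the arm deterministic; its new sample is
then independent of the past, its Gaussian density converts the inner integral from `μ` to `ν`, and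
the induction hypothesis converts the past. -/
theorem lintegral_obs_eq (μ ν : Fin M → EuclideanSpace ℝ (Fin d)) (t : ℕ)
    {F : π.Seed × History M d t → ℝ≥0∞} (hF : Measurable F) :
    ∫⁻ ω, F (π.obs t ω) * ENNReal.ofReal (Real.exp (-historyLLR μ ν (π.obs t ω).2)) ∂π.law μ =
      ∫⁻ ω, F (π.obs t ω) ∂π.law ν := by
  induction t with
  | zero =>
    -- Before any pull only the seed is seen, and its law is the same on all instances.
    have h1 : ∀ ξ : Fin M → EuclideanSpace ℝ (Fin d), ∫⁻ ω, F (π.obs 0 ω) ∂π.law ξ =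
        ∫⁻ s, F (s, Fin.elim0) ∂π.seedLaw := fun ξ => by
      have : Measurable fun s => F (s, Fin.elim0) :=
        hF.comp (measurable_id.prodMk measurable_const)
      rw [law]
      exact measurePreserving_fst.lintegral_comp this
    simp [historyLLR, h1]
  | succ t ih =>
    let N : EuclideanSpace ℝ (Fin d) → Measure (EuclideanSpace ℝ (Fin d)) := fun m =>
      multivariateGaussian m (1 : Matrix (Fin d) (Fin d) ℝ)
    let next : Fin M → (π.Seed × History M d t) × EuclideanSpace ℝ (Fin d) →
        π.Seed × History M d (t + 1) := fun a p =>
      (p.1.1, Fin.snoc (α := fun _ => Fin M × EuclideanSpace ℝ (Fin d)) p.1.2 (a, p.2))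
    have hnext : ∀ a, Measurable (next a) := fun a => by
      refine (measurable_fst.comp measurable_fst).prodMk (measurable_pi_lambda _ fun i => ?_)
      refine Fin.lastCases ?_ (fun j => ?_) i
      · simpa using measurable_const.prodMk measurable_snd
      · simpa [Function.comp_def] using
          (measurable_pi_apply j).comp (measurable_snd.comp measurable_fst)
    -- The indicator that arm `a` is selected lets a sum over fixed arms replace the random index.
    let G : Fin M → (π.Seed × History M d t) × EuclideanSpace ℝ (Fin d) → ℝ≥0∞ := fun a p =>
      (π.arm t ⁻¹' {a}).indicator 1 p.1 * F (next a p)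
    have hG : ∀ a, Measurable (G a) := fun a =>
      ((measurable_one.indicator (π.measurable_arm t (measurableSet_singleton a))).comp
        measurable_fst).mul (hF.comp (hnext a))
    have hsum : ∀ ω : π.Outcome, ∀ H : Fin M → ℝ≥0∞,
        H (π.selected t ω) * F (π.obs (t + 1) ω) =
          ∑ a, H a * G a (π.obs t ω, ω.2 (t, a)) := fun ω H => by
      rw [Finset.sum_eq_single (π.selected t ω)]
      · have : π.obs t ω ∈ π.arm t ⁻¹' {π.selected t ω} := rfl
        simp only [G, Set.indicator_of_mem this, Pi.one_apply, one_mul]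
        rfl
      · intro a _ ha
        have : π.obs t ω ∉ π.arm t ⁻¹' {a} := fun h => ha (Eq.symm h)
        simp [G, this]
      · simp
    let r : Fin M → EuclideanSpace ℝ (Fin d) → ℝ≥0∞ := fun a z =>
      ENNReal.ofReal (Real.exp (-gaussianLLR (μ a) (ν a) z))
    have hr : ∀ a, Measurable (r a) := fun a =>
      (measurable_gaussianLLR _ _).neg.exp.ennreal_ofReal
    let l : π.Seed × History M d t → ℝ≥0∞ := fun p =>
      ENNReal.ofReal (Real.exp (-historyLLR μ ν p.2))
    have hl : Measurable l :=
      ((measurable_historyLLR μ ν t).comp measurable_snd).neg.exp.ennreal_ofReal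
    have hsamp : ∀ a, Measurable fun ω : π.Outcome => (π.obs t ω, ω.2 (t, a)) := fun a =>
      (π.measurable_obs t).prodMk ((measurable_pi_apply _).comp measurable_snd)
    have hleft : ∀ ω : π.Outcome, F (π.obs (t + 1) ω) *
        ENNReal.ofReal (Real.exp (-historyLLR μ ν (π.obs (t + 1) ω).2)) =
        ∑ a, l (π.obs t ω) * r a (ω.2 (t, a)) * G a (π.obs t ω, ω.2 (t, a)) := fun ω => by
      rw [← hsum ω fun a => l (π.obs t ω) * r a (ω.2 (t, a)), mul_comm]
      congr 1
      simp only [l, r, obs]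
      rw [← ENNReal.ofReal_mul (Real.exp_pos _).le, ← Real.exp_add, historyLLR_history,
        historyLLR_history, Finset.sum_range_succ, neg_add]
      rfl
    have hright : ∀ ω : π.Outcome, F (π.obs (t + 1) ω) =
        ∑ a, G a (π.obs t ω, ω.2 (t, a)) := fun ω => by
      simpa using hsum ω fun _ => 1
    simp_rw [hleft, hright]
    rw [lintegral_finsetSum, lintegral_finsetSum]
    · refine Finset.sum_congr rfl fun a _ => ?_
      rw [π.lintegral_obs_sample ν t a (hG a),
        π.lintegral_obs_sample μ t a (F := fun p => l p.1 * r a p.2 * G a p)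
          (((hl.comp measurable_fst).mul ((hr a).comp measurable_snd)).mul (hG a)),
        ← ih (F := fun p => ∫⁻ z, G a (p, z) ∂N (ν a)) (hG a).lintegral_prod_right']
      refine lintegral_congr fun ω => ?_
      have hGz : Measurable fun z => G a (π.obs t ω, z) :=
        (hG a).comp (measurable_const.prodMk measurable_id)
      simp only [N, mul_assoc]
      rw [multivariateGaussian_one_eq_withDensity (μ a) (ν a),
        lintegral_withDensity_eq_lintegral_mul _ (hr a) hGz, mul_comm]
      exact lintegral_const_mul _ ((hr a).mul hGz)
    · exact fun a _ => (hG a).comp (hsamp a)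
    · have hX : ∀ a, Measurable fun ω : π.Outcome => ω.2 (t, a) := fun a =>
        (measurable_pi_apply (t, a)).comp measurable_snd
      exact fun a _ => ((hl.comp (π.measurable_obs t)).mul ((hr a).comp (hX a))).mul
        ((hG a).comp (hsamp a))

end BanditAlgorithm

/-! ### Change of measure up to the stopping time -/

namespace BanditAlgorithm

variable {M K d : ℕ} (π : BanditAlgorithm.{u} M K d)

theorem measure_eq_sum_stopsAt (ρ : Measure π.Outcome) (A : Set π.Outcome) (n : ℕ) :
    ρ A = ∑ t ∈ Finset.range n, ρ (A ∩ π.stopsAt t) + ρ (A ∩ π.notStoppedBefore n) := by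
  induction n with
  | zero => simp [notStoppedBefore]
  | succ n ih =>
    have hs : A ∩ π.stopsAt n = (A ∩ π.notStoppedBefore n) ∩ {ω | π.Stops ω n} := by
      ext ω; simp [stopsAt, and_assoc]
    rw [ih, Finset.sum_range_succ, add_assoc, notStoppedBefore_succ, hs, ← Set.inter_assoc,
      ← Set.sdiff_eq, measure_inter_add_sdiff _ (π.isObservable_stops n).measurableSet]

/-- The log-likelihood ratio of the instances `μ` and `ν` on the samples obtained up to the
stopping time, or up to time `n` if this comes first. -/
noncomputable def stoppedLLR (μ ν : Fin M → EuclideanSpace ℝ (Fin d)) (n : ℕ) (ω : π.Outcome) :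
    ℝ :=
  ∑ s ∈ Finset.range n, (π.notStoppedBefore (s + 1)).indicator (π.sampleLLR μ ν s) ω

theorem measurable_gaussianLLR_sample (μ ν : Fin M → EuclideanSpace ℝ (Fin d)) (t : ℕ) :
    Measurable fun p : Fin M × π.Outcome =>
      gaussianLLR (μ p.1) (ν p.1) (p.2.2 (t, p.1)) := by
  refine measurable_from_prod_countable_right fun a => ?_
  have hX : Measurable fun ω : π.Outcome => ω.2 (t, a) :=
    (measurable_pi_apply (t, a)).comp measurable_snd
  exact (measurable_gaussianLLR (μ a) (ν a)).comp hX

theorem measurable_sampleLLR (μ ν : Fin M → EuclideanSpace ℝ (Fin d)) (t : ℕ) :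
    Measurable (π.sampleLLR μ ν t) :=
  Measurable.comp (f := fun ω : π.Outcome => (π.selected t ω, ω))
    (π.measurable_gaussianLLR_sample μ ν t) ((π.measurable_selected t).prodMk measurable_id)

theorem measurable_stoppedLLR (μ ν : Fin M → EuclideanSpace ℝ (Fin d)) (n : ℕ) :
    Measurable (π.stoppedLLR μ ν n) :=
  Finset.measurable_sum _ fun s _ => (π.measurable_sampleLLR μ ν s).indicator
    (π.isObservable_notStoppedBefore _).measurableSet

theorem stoppedLLR_of_stopsAt (μ ν : Fin M → EuclideanSpace ℝ (Fin d)) {n t : ℕ} (ht : t ≤ n)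
    {ω : π.Outcome} (hω : ω ∈ π.stopsAt t) :
    π.stoppedLLR μ ν n ω = historyLLR μ ν (π.history ω t) := by
  rw [historyLLR_history, stoppedLLR,
    ← Finset.sum_subset (Finset.range_mono ht) (fun s _ hs => ?_)]
  · refine Finset.sum_congr rfl fun s hs => Set.indicator_of_mem ?_ _
    exact (π.mem_notStoppedBefore_iff_of_stopsAt hω s).2 (Finset.mem_range.1 hs)
  · refine Set.indicator_of_notMem (fun h => hs ?_) _
    exact Finset.mem_range.2 ((π.mem_notStoppedBefore_iff_of_stopsAt hω s).1 h)

theorem stoppedLLR_of_notStoppedBefore (μ ν : Fin M → EuclideanSpace ℝ (Fin d)) {n : ℕ}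
    {ω : π.Outcome} (hω : ω ∈ π.notStoppedBefore n) :
    π.stoppedLLR μ ν n ω = historyLLR μ ν (π.history ω n) := by
  rw [historyLLR_history, stoppedLLR]
  refine Finset.sum_congr rfl fun s hs => Set.indicator_of_mem ?_ _
  exact fun r hr => hω r (by have := Finset.mem_range.1 hs; omega)

/-- An event is determined by the observations up to the stopping time, or up to time `n` if this
comes first. -/
structure IsStoppedObservable (n : ℕ) (A : Set π.Outcome) : Prop where
  inter_stopsAt : ∀ t < n, π.IsObservable t (A ∩ π.stopsAt t)
  inter_notStoppedBefore : π.IsObservable n (A ∩ π.notStoppedBefore n)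

theorem setLIntegral_observable_eq (μ ν : Fin M → EuclideanSpace ℝ (Fin d)) {t : ℕ}
    {A : Set π.Outcome} (hA : π.IsObservable t A) :
    ∫⁻ ω in A, ENNReal.ofReal (Real.exp (-historyLLR μ ν (π.history ω t))) ∂π.law μ =
      π.law ν A := by
  have hA' := hA.measurableSet
  obtain ⟨B, hB, rfl⟩ := hA
  have h := π.lintegral_obs_eq μ ν t (measurable_one.indicator hB)
  have h1 : ∀ ω : π.Outcome, B.indicator (1 : π.Seed × History M d t → ℝ≥0∞) (π.obs t ω) =
      (π.obs t ⁻¹' B).indicator 1 ω := fun ω => rfl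
  simp_rw [h1] at h
  rw [lintegral_indicator_one hA'] at h
  rw [← h, ← lintegral_indicator hA']
  refine lintegral_congr fun ω => ?_
  by_cases hω : ω ∈ π.obs t ⁻¹' B <;> simp [hω, obs]

/-- On each piece, stopping at a given `t < n` or no stop before `n`, the stopped ratio is that of a
history of fixed length. The fixed-time identity therefore applies piecewise, without optional
stopping. -/
theorem setLIntegral_stoppedObservable_eq (μ ν : Fin M → EuclideanSpace ℝ (Fin d)) {n : ℕ}
    {A : Set π.Outcome} (hA : π.IsStoppedObservable n A) :
    ∫⁻ ω in A, ENNReal.ofReal (Real.exp (-π.stoppedLLR μ ν n ω)) ∂π.law μ = π.law ν A := by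
  rw [← withDensity_apply', π.measure_eq_sum_stopsAt _ A n, π.measure_eq_sum_stopsAt _ A n]
  congr 1
  · refine Finset.sum_congr rfl fun t ht => ?_
    have ht := Finset.mem_range.1 ht
    rw [withDensity_apply', ← π.setLIntegral_observable_eq μ ν (hA.inter_stopsAt t ht)]
    refine setLIntegral_congr_fun (hA.inter_stopsAt t ht).measurableSet fun ω hω => ?_
    simp only [π.stoppedLLR_of_stopsAt μ ν ht.le hω.2]
  · rw [withDensity_apply', ← π.setLIntegral_observable_eq μ ν hA.inter_notStoppedBefore]
    refine setLIntegral_congr_fun hA.inter_notStoppedBefore.measurableSet fun ω hω => ?_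
    simp only [π.stoppedLLR_of_notStoppedBefore μ ν hω.2]

variable {π} in
theorem IsStoppedObservable.compl {n : ℕ} {A : Set π.Outcome} (hA : π.IsStoppedObservable n A) :
    π.IsStoppedObservable n Aᶜ := by
  have h : ∀ B : Set π.Outcome, Aᶜ ∩ B = B ∩ (A ∩ B)ᶜ := fun B => by
    ext ω; simp only [Set.mem_inter_iff, Set.mem_compl_iff]; tauto
  refine ⟨fun t ht => ?_, ?_⟩
  · rw [h]; exact (π.isObservable_stopsAt t).inter (hA.inter_stopsAt t ht).compl
  · rw [h]; exact (π.isObservable_notStoppedBefore n).inter hA.inter_notStoppedBefore.compl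

theorem isStoppedObservable_univ (n : ℕ) : π.IsStoppedObservable n Set.univ :=
  ⟨fun t _ => by simpa using π.isObservable_stopsAt t,
    by simpa using π.isObservable_notStoppedBefore n⟩

/-! ### Expectation of the log-likelihood ratio -/

theorem integrable_and_integral_sample (μ : Fin M → EuclideanSpace ℝ (Fin d)) (t : ℕ) (a : Fin M)
    {A : Set π.Outcome} (hA : π.IsObservable t A) {g : EuclideanSpace ℝ (Fin d) → ℝ}
    (hg : Measurable g)
    (hgi : Integrable g (multivariateGaussian (μ a) (1 : Matrix (Fin d) (Fin d) ℝ))) :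
    Integrable (A.indicator fun ω => g (ω.2 (t, a))) (π.law μ) ∧
      ∫ ω, A.indicator (fun ω => g (ω.2 (t, a))) ω ∂π.law μ = (π.law μ).real A *
        ∫ z, g z ∂multivariateGaussian (μ a) (1 : Matrix (Fin d) (Fin d) ℝ) := by
  have hAm := hA.measurableSet
  have hres := π.measurePreserving_resample μ t a
  have hm : Measurable (A.indicator fun ω : π.Outcome => g (ω.2 (t, a))) :=
    (hg.comp ((measurable_pi_apply (t, a)).comp measurable_snd)).indicator hAm
  -- After resampling, the event depends only on the old outcome and `g` only on the fresh draw.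
  have heq : (fun p : π.Outcome × EuclideanSpace ℝ (Fin d) =>
      A.indicator (fun ω : π.Outcome => g (ω.2 (t, a)))
        (p.1.1, Function.update p.1.2 (t, a) p.2)) = fun p => A.indicator 1 p.1 * g p.2 := by
    obtain ⟨B, hB, rfl⟩ := hA
    ext p
    by_cases hp : π.obs t p.1 ∈ B
    · have : π.obs t (p.1.1, Function.update p.1.2 (t, a) p.2) ∈ B := by
        rwa [π.obs_update _ le_rfl]
      simp [Set.indicator, hp, this]
    · have : π.obs t (p.1.1, Function.update p.1.2 (t, a) p.2) ∉ B := by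
        rwa [π.obs_update _ le_rfl]
      simp [Set.indicator, hp, this]
  have h1 : Integrable (A.indicator (1 : π.Outcome → ℝ)) (π.law μ) :=
    (integrable_const (1 : ℝ)).indicator hAm
  constructor
  · rw [← hres.integrable_comp hm.aestronglyMeasurable]
    exact (h1.mul_prod hgi).congr (ae_of_all _ fun p => (congrFun heq p).symm)
  · conv_lhs => rw [← hres.map_eq]
    rw [integral_map hres.measurable.aemeasurable hm.aestronglyMeasurable, heq,
      integral_prod_mul, integral_indicator_one hAm]

theorem indicator_sampleLLR_eq_sum (μ ν : Fin M → EuclideanSpace ℝ (Fin d)) (t : ℕ)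
    (A : Set π.Outcome) : A.indicator (π.sampleLLR μ ν t) = fun ω => ∑ a,
      (A ∩ {ω | π.selected t ω = a}).indicator
        (fun ω => gaussianLLR (μ a) (ν a) (ω.2 (t, a))) ω := by
  ext ω
  rw [Finset.sum_eq_single (π.selected t ω)]
  · by_cases hω : ω ∈ A <;> simp [Set.indicator, hω, sampleLLR]
  · intro a _ ha
    refine Set.indicator_of_notMem (fun h => ha h.2.symm) _
  · simp

theorem isObservable_pull (t : ℕ) (a : Fin M) :
    π.IsObservable t (π.notStoppedBefore (t + 1) ∩ {ω | π.selected t ω = a}) :=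
  (π.isObservable_notStoppedBefore_succ t).inter (π.isObservable_selected t a)

theorem integrable_stoppedLLR (μ ν : Fin M → EuclideanSpace ℝ (Fin d)) (n : ℕ) :
    Integrable (π.stoppedLLR μ ν n) (π.law μ) := by
  refine integrable_finsetSum _ fun s _ => ?_
  rw [indicator_sampleLLR_eq_sum]
  exact integrable_finsetSum _ fun a _ => (π.integrable_and_integral_sample μ s a
    (π.isObservable_pull s a) (measurable_gaussianLLR _ _) (integrable_gaussianLLR _ _)).1

/-- Wald's identity: the decision to pull arm `a` at time `s` is independent of that sample, whose
mean log-likelihood ratio is `‖ν a - μ a‖ ^ 2 / 2`. -/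
theorem integral_stoppedLLR (μ ν : Fin M → EuclideanSpace ℝ (Fin d)) (n : ℕ) :
    ∫ ω, π.stoppedLLR μ ν n ω ∂π.law μ = ∑ s ∈ Finset.range n, ∑ a,
      (π.law μ).real (π.notStoppedBefore (s + 1) ∩ {ω | π.selected s ω = a}) *
        (‖ν a - μ a‖ ^ 2 / 2) := by
  have h := fun s a => π.integrable_and_integral_sample μ s a
    (π.isObservable_pull s a) (measurable_gaussianLLR (μ a) (ν a)) (integrable_gaussianLLR _ _)
  unfold stoppedLLR
  simp_rw [indicator_sampleLLR_eq_sum]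
  rw [integral_finsetSum _ fun s _ => integrable_finsetSum _ fun a _ => (h s a).1]
  refine Finset.sum_congr rfl fun s _ => ?_
  rw [integral_finsetSum _ fun a _ => (h s a).1]
  exact Finset.sum_congr rfl fun a _ => by rw [(h s a).2, integral_gaussianLLR]

/-- The expected number of pulls of an arm. -/
noncomputable def expectedPulls (μ : Fin M → EuclideanSpace ℝ (Fin d)) (a : Fin M) : ℝ≥0∞ :=
  ∑' s, π.law μ (π.notStoppedBefore (s + 1) ∩ {ω | π.selected s ω = a})

theorem sum_expectedPulls (μ : Fin M → EuclideanSpace ℝ (Fin d)) :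
    ∑ a, π.expectedPulls μ a = π.expectedSamples μ := by
  unfold expectedPulls
  rw [expectedSamples_eq_tsum, ← Summable.tsum_finsetSum fun _ _ => ENNReal.summable]
  refine tsum_congr fun s => ?_
  rw [← measure_biUnion_finset]
  · congr 1
    ext ω
    simp
  · intro a _ b _ hab
    rw [Function.onFun, Set.disjoint_left]
    exact fun ω h h' => hab (h.2.symm.trans h'.2)
  · exact fun a _ => (π.isObservable_pull s a).measurableSet

theorem ofReal_integral_stoppedLLR_le (μ ν : Fin M → EuclideanSpace ℝ (Fin d)) (n : ℕ) :
    ENNReal.ofReal (∫ ω, π.stoppedLLR μ ν n ω ∂π.law μ) ≤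
      ∑ a, π.expectedPulls μ a * ENNReal.ofReal (‖ν a - μ a‖ ^ 2 / 2) := by
  rw [integral_stoppedLLR, Finset.sum_comm, ENNReal.ofReal_sum_of_nonneg
    fun a _ => Finset.sum_nonneg fun s _ => by positivity]
  refine Finset.sum_le_sum fun a _ => ?_
  rw [← Finset.sum_mul, ENNReal.ofReal_mul (Finset.sum_nonneg fun s _ => by positivity),
    ENNReal.ofReal_sum_of_nonneg fun s _ => by positivity]
  gcongr
  rw [Finset.sum_congr rfl fun s _ => ofReal_measureReal]
  exact ENNReal.sum_le_tsum _

/-! ### The transportation inequality -/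

/-- Apply `1 + x ≤ exp x` with `x = log R - L` on `A` and `x = -log R - L` on `Aᶜ`, where `L` is the
stopped ratio and `R = (1 - δ) / δ`. Integrated, the exponentials become `R` and `R⁻¹` times
probabilities under `ν`. -/
theorem le_integral_stoppedLLR (μ ν : Fin M → EuclideanSpace ℝ (Fin d)) {n : ℕ}
    {A : Set π.Outcome} (hAm : MeasurableSet A) (hA : π.IsStoppedObservable n A) {δ : ℝ}
    (hδ : 0 < δ) (hδ' : δ ≤ 1 / 2) (hν : (π.law ν).real A ≤ δ) :
    (2 * (π.law μ).real A - 1) * Real.log ((1 - δ) / δ) ≤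
      ∫ ω, π.stoppedLLR μ ν n ω ∂π.law μ := by
  set R := (1 - δ) / δ with hR
  set Z : π.Outcome → ℝ := fun ω => Real.exp (-π.stoppedLLR μ ν n ω) with hZ
  have hRpos : 0 < R := div_pos (by linarith) hδ
  have hZm : Measurable Z := (π.measurable_stoppedLLR μ ν n).neg.exp
  have hZi : Integrable Z (π.law μ) := by
    refine ⟨hZm.aestronglyMeasurable, ?_⟩
    rw [hasFiniteIntegral_iff_ofReal (ae_of_all _ fun ω => (Real.exp_pos _).le)]
    have := π.setLIntegral_stoppedObservable_eq μ ν (π.isStoppedObservable_univ n)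
    rw [Measure.restrict_univ, measure_univ] at this
    rw [this]
    exact ENNReal.one_lt_top
  have hset : ∀ B : Set π.Outcome, π.IsStoppedObservable n B →
      ∫ ω in B, Z ω ∂π.law μ = (π.law ν).real B := fun B hB => by
    rw [integral_eq_lintegral_of_nonneg_ae (ae_of_all _ fun ω => (Real.exp_pos _).le)
      hZm.aestronglyMeasurable, π.setLIntegral_stoppedObservable_eq μ ν hB, measureReal_def]
  have hcompl : ∀ ξ, (π.law ξ).real Aᶜ = 1 - (π.law ξ).real A := fun ξ => by
    rw [measureReal_compl hAm, probReal_univ]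
  have hL := π.integrable_stoppedLLR μ ν n
  have hbA : ∫ ω in A, (Real.log R + 1 - π.stoppedLLR μ ν n ω) ∂π.law μ ≤
      ∫ ω in A, R * Z ω ∂π.law μ := by
    refine integral_mono (((integrable_const _).sub hL).restrict)
      ((hZi.const_mul R).restrict) fun ω => ?_
    have := Real.add_one_le_exp (Real.log R - π.stoppedLLR μ ν n ω)
    rw [sub_eq_add_neg, Real.exp_add, Real.exp_log hRpos] at this
    simp only [hZ]
    linarith
  have hbAc : ∫ ω in Aᶜ, (-Real.log R + 1 - π.stoppedLLR μ ν n ω) ∂π.law μ ≤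
      ∫ ω in Aᶜ, R⁻¹ * Z ω ∂π.law μ := by
    refine integral_mono (((integrable_const _).sub hL).restrict)
      ((hZi.const_mul R⁻¹).restrict) fun ω => ?_
    have := Real.add_one_le_exp (-Real.log R - π.stoppedLLR μ ν n ω)
    rw [sub_eq_add_neg, Real.exp_add, Real.exp_neg (Real.log R), Real.exp_log hRpos] at this
    simp only [hZ]
    linarith
  rw [integral_sub (integrable_const _) hL.restrict, integral_const_mul, hset _ hA] at hbA
  rw [integral_sub (integrable_const _) hL.restrict, integral_const_mul, hset _ hA.compl,
    hcompl] at hbAc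
  simp only [integral_const, measureReal_restrict_apply_univ, smul_eq_mul, hcompl] at hbA hbAc
  have hsplit := integral_add_compl hAm hL
  -- As `R⁻¹ ≤ R`, the left side is nondecreasing in the probability of `A`; at the value `δ` it
  -- equals `(1 - δ) + δ`. This explains the choice of `R`.
  have hq : R * (π.law ν).real A + R⁻¹ * (1 - (π.law ν).real A) ≤ 1 := by
    have h1 : R * δ = 1 - δ := by rw [hR]; field_simp
    have hR1 : 1 ≤ R := by rw [hR, le_div_iff₀ hδ]; linarith
    have h2 : R⁻¹ * (1 - δ) = δ := by rw [← h1, inv_mul_cancel_left₀ hRpos.ne']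
    have h3 : R⁻¹ ≤ R := (inv_le_one_of_one_le₀ hR1).trans hR1
    nlinarith [mul_nonneg (sub_nonneg.2 h3) (sub_nonneg.2 hν)]
  linarith

/-! ### Declaration events and removal of the truncation -/

theorem isObservable_sameClustering (t : ℕ) (c : Fin M → Fin K) :
    π.IsObservable t {ω | SameClustering (π.output t (π.obs t ω)) c} :=
  ⟨π.output t ⁻¹' {c' | SameClustering c' c},
    π.measurable_output t (Set.toFinite _).measurableSet, rfl⟩

/-- The event that the algorithm stops after fewer than `n` pulls and declares `c`, up to a
permutation of the labels. -/
def declaresBefore (c : Fin M → Fin K) (n : ℕ) : Set π.Outcome :=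
  ⋃ t < n, π.stopsAt t ∩ {ω | SameClustering (π.output t (π.obs t ω)) c}

theorem iUnion_declaresBefore (c : Fin M → Fin K) : ⋃ n, π.declaresBefore c n = π.declares c := by
  ext ω
  simp only [declaresBefore, declares, stoppingTime_eq_natCast_iff, Set.mem_iUnion,
    Set.mem_inter_iff, Set.mem_ofPred_eq, exists_prop]
  exact ⟨fun ⟨_, t, _, h⟩ => ⟨t, h⟩, fun ⟨t, h⟩ => ⟨t + 1, t, t.lt_succ_self, h⟩⟩

theorem monotone_declaresBefore (c : Fin M → Fin K) : Monotone (π.declaresBefore c) :=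
  fun _ _ h => Set.biUnion_mono (fun _ ht => lt_of_lt_of_le ht h) fun _ _ => subset_rfl

theorem measurableSet_declaresBefore (c : Fin M → Fin K) (n : ℕ) :
    MeasurableSet (π.declaresBefore c n) :=
  .iUnion fun t => .iUnion fun _ =>
    ((π.isObservable_stopsAt t).inter (π.isObservable_sameClustering t c)).measurableSet

theorem measurableSet_declares (c : Fin M → Fin K) : MeasurableSet (π.declares c) := by
  rw [← iUnion_declaresBefore]
  exact .iUnion (π.measurableSet_declaresBefore c)

theorem stopsAt_unique {ω : π.Outcome} {s t : ℕ} (hs : ω ∈ π.stopsAt s) (ht : ω ∈ π.stopsAt t) :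
    s = t := by
  have := π.stoppingTime_of_stopsAt hs
  rw [π.stoppingTime_of_stopsAt ht] at this
  exact (Nat.cast_injective this).symm

theorem isStoppedObservable_declaresBefore (c : Fin M → Fin K) (n : ℕ) :
    π.IsStoppedObservable n (π.declaresBefore c n) := by
  refine ⟨fun t ht => ?_, ?_⟩
  · convert (π.isObservable_stopsAt t).inter (π.isObservable_sameClustering t c) using 1
    ext ω
    simp only [declaresBefore, Set.mem_iUnion, Set.mem_inter_iff, exists_prop]
    constructor
    · rintro ⟨⟨s, _, hs, hc⟩, hω⟩
      obtain rfl := π.stopsAt_unique hs hω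
      exact ⟨hω, hc⟩
    · exact fun h => ⟨⟨t, ht, h⟩, h.1⟩
  · refine ⟨∅, .empty, ?_⟩
    ext ω
    rw [Set.preimage_empty, iff_comm]
    simp only [declaresBefore, Set.mem_iUnion, Set.mem_inter_iff, exists_prop,
      Set.mem_empty_iff_false, iff_false]
    rintro ⟨⟨s, hs, hω, _⟩, h⟩
    exact h s hs hω.2

/-- The truncated declarations increase to the full one, and the right side is free of `n`, so only
probabilities have to converge. -/
theorem ofReal_log_le_sum_expectedPulls (μ ν : Fin M → EuclideanSpace ℝ (Fin d))
    (c : Fin M → Fin K) {δ : ℝ} (hδ : 0 < δ) (hδ' : δ ≤ 1 / 2)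
    (hμ : 1 - δ ≤ (π.law μ).real (π.declares c)) (hν : (π.law ν).real (π.declares c) ≤ δ) :
    ENNReal.ofReal ((1 - 2 * δ) * Real.log ((1 - δ) / δ)) ≤
      ∑ a, π.expectedPulls μ a * ENNReal.ofReal (‖ν a - μ a‖ ^ 2 / 2) := by
  have hlog : 0 ≤ Real.log ((1 - δ) / δ) :=
    Real.log_nonneg (by rw [le_div_iff₀ hδ]; linarith)
  have hlim : Tendsto (fun n => ENNReal.ofReal
      ((2 * (π.law μ).real (π.declaresBefore c n) - 1) * Real.log ((1 - δ) / δ))) atTop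
      (𝓝 (ENNReal.ofReal
        ((2 * (π.law μ).real (π.declares c) - 1) * Real.log ((1 - δ) / δ)))) := by
    refine ENNReal.tendsto_ofReal (((Tendsto.const_mul 2 ?_).sub_const 1).mul_const _)
    rw [← iUnion_declaresBefore]
    exact (ENNReal.tendsto_toReal (measure_ne_top _ _)).comp
      (tendsto_measure_iUnion_atTop (π.monotone_declaresBefore c))
  refine le_trans (ENNReal.ofReal_le_ofReal (mul_le_mul_of_nonneg_right (by linarith) hlog))
    (le_of_tendsto' hlim fun n => ?_)
  refine le_trans (ENNReal.ofReal_le_ofReal ?_) (π.ofReal_integral_stoppedLLR_le μ ν n)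
  refine π.le_integral_stoppedLLR μ ν (π.measurableSet_declaresBefore c n)
    (π.isStoppedObservable_declaresBefore c n) hδ hδ' (le_trans (measureReal_mono ?_) hν)
  rw [← iUnion_declaresBefore]
  exact Set.subset_iUnion _ n

end BanditAlgorithm

/-! ### The Bernoulli divergence -/

theorem bernoulliMeasure_eq_withDensity {p q : unitInterval} (hq0 : (q : ℝ) ≠ 0)
    (hq1 : (q : ℝ) ≠ 1) :
    bernoulliMeasure true false p = (bernoulliMeasure true false q).withDensity fun b =>
      ENNReal.ofReal (if b then p / q else (1 - p) / (1 - q)) := by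
  have hq : (0 : ℝ) < q := lt_of_le_of_ne q.2.1 hq0.symm
  have hq' : (0 : ℝ) < 1 - q := sub_pos.2 (lt_of_le_of_ne q.2.2 hq1)
  refine Measure.ext_of_singleton fun b => ?_
  rw [withDensity_apply _ (measurableSet_singleton _), lintegral_singleton]
  have h : ∀ (r : unitInterval), bernoulliMeasure true false r {b} =
      ENNReal.ofReal (if b then r else 1 - r) := fun r => by
    rw [← ofReal_measureReal, bernoulliMeasure_real_apply r (measurableSet_singleton b)]
    cases b <;> simp
  rw [h, h]
  cases b
  · simp only [Bool.false_eq_true, if_false]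
    rw [← ENNReal.ofReal_mul (div_nonneg (sub_nonneg.2 p.2.2) hq'.le), div_mul_cancel₀ _ hq'.ne']
  · simp only [if_true]
    rw [← ENNReal.ofReal_mul (div_nonneg p.2.1 hq.le), div_mul_cancel₀ _ hq.ne']

theorem bernoulliKL_eq {a b : ℝ} (ha : 0 < a) (ha' : a < 1) (hb : 0 < b) (hb' : b < 1) :
    bernoulliKL a b =
      ENNReal.ofReal (a * Real.log (a / b) + (1 - a) * Real.log ((1 - a) / (1 - b))) := by
  rw [bernoulliKL]
  have hpa : (Set.projIcc (0 : ℝ) 1 zero_le_one a : ℝ) = a :=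
    congrArg Subtype.val (Set.projIcc_of_mem zero_le_one ⟨ha.le, ha'.le⟩)
  have hpb : (Set.projIcc (0 : ℝ) 1 zero_le_one b : ℝ) = b :=
    congrArg Subtype.val (Set.projIcc_of_mem zero_le_one ⟨hb.le, hb'.le⟩)
  set p := Set.projIcc (0 : ℝ) 1 zero_le_one a
  set q := Set.projIcc (0 : ℝ) 1 zero_le_one b
  have hd := bernoulliMeasure_eq_withDensity (p := p) (q := q) (by rw [hpb]; exact hb.ne')
    (by rw [hpb]; exact hb'.ne)
  rw [hpa, hpb] at hd
  have hac : bernoulliMeasure true false p ≪ bernoulliMeasure true false q := by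
    rw [hd]; exact withDensity_absolutelyContinuous _ _
  have hllr : llr (bernoulliMeasure true false p) (bernoulliMeasure true false q)
      =ᵐ[bernoulliMeasure true false p]
      fun c => Real.log (if c then a / b else (1 - a) / (1 - b)) := by
    have h := Measure.rnDeriv_withDensity (bernoulliMeasure true false q)
      (f := fun c => ENNReal.ofReal (if c then a / b else (1 - a) / (1 - b)))
      (measurable_of_countable _)
    rw [← hd] at h
    filter_upwards [hac.ae_le h] with c hc
    rw [llr, hc, ENNReal.toReal_ofReal]
    split_ifs
    · positivity
    · exact div_nonneg (by linarith) (by linarith)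
  rw [InformationTheory.klDiv_of_ac_of_integrable hac
    ((integrable_bernoulliMeasure _ _ _ _).congr hllr.symm), integral_congr_ae hllr,
    integral_bernoulliMeasure]
  simp [hpa]

theorem bernoulliKL_one_sub {δ : ℝ} (hδ : 0 < δ) (hδ' : δ < 1) :
    bernoulliKL δ (1 - δ) = ENNReal.ofReal ((1 - 2 * δ) * Real.log ((1 - δ) / δ)) := by
  rw [bernoulliKL_eq hδ hδ' (by linarith) (by linarith), sub_sub_cancel,
    ← inv_div (1 - δ) δ, Real.log_inv]
  congr 1
  ring

/-- Since `log ((1 - δ) / δ) = log (1 - δ) + log (1 / δ)`, the first summand is negligible and the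
factor `1 - 2 * δ` tends to `1`. -/
theorem tendsto_bernoulliKL_div_log :
    Tendsto (fun δ : ℝ => bernoulliKL δ (1 - δ) / ENNReal.ofReal (Real.log (1 / δ))) (𝓝[>] 0)
      (𝓝 1) := by
  have hlog : Tendsto (fun δ : ℝ => Real.log (1 / δ)) (𝓝[>] 0) atTop := by
    simp_rw [one_div]
    exact Real.tendsto_log_atTop.comp tendsto_inv_nhdsGT_zero
  have hid : Tendsto (fun δ : ℝ => δ) (𝓝[>] 0) (𝓝 0) :=
    tendsto_nhdsWithin_of_tendsto_nhds tendsto_id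
  have h1 : Tendsto (fun δ : ℝ => Real.log (1 - δ)) (𝓝[>] 0) (𝓝 0) := by
    have h : Tendsto (fun δ : ℝ => 1 - δ) (𝓝[>] 0) (𝓝 1) := by simpa using hid.const_sub 1
    simpa using h.log one_ne_zero
  have h2 : Tendsto (fun δ : ℝ => (1 - 2 * δ) * (Real.log (1 - δ) / Real.log (1 / δ) + 1))
      (𝓝[>] 0) (𝓝 1) := by
    have h3 : Tendsto (fun δ : ℝ => 1 - 2 * δ) (𝓝[>] 0) (𝓝 1) := by
      simpa using (hid.const_mul 2).const_sub 1
    simpa using h3.mul ((h1.div_atTop hlog).add_const 1)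
  have h4 := ENNReal.tendsto_ofReal h2
  rw [ENNReal.ofReal_one] at h4
  refine h4.congr' ?_
  filter_upwards [Ioo_mem_nhdsGT (zero_lt_one' ℝ)] with δ hδ
  have hpos : 0 < Real.log (1 / δ) := Real.log_pos (by rw [lt_div_iff₀ hδ.1]; linarith [hδ.2])
  rw [bernoulliKL_one_sub hδ.1 hδ.2, ← ENNReal.ofReal_div_of_pos hpos]
  congr 1
  rw [mul_div_assoc]
  congr 1
  have : (1 - δ) / δ = (1 - δ) * (1 / δ) := by ring
  rw [this, Real.log_mul (by linarith [hδ.2]) (one_div_pos.2 hδ.1).ne', add_div,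
    div_self hpos.ne']

/-! ### The lower bound -/

theorem SameClustering.symm {M K : ℕ} {c c' : Fin M → Fin K} (h : SameClustering c c') :
    SameClustering c' c := by
  obtain ⟨σ, rfl⟩ := h
  exact ⟨σ.symm, by ext; simp⟩

theorem SameClustering.trans {M K : ℕ} {c c' c'' : Fin M → Fin K} (h : SameClustering c c')
    (h' : SameClustering c' c'') : SameClustering c c'' := by
  obtain ⟨σ, rfl⟩ := h
  obtain ⟨τ, rfl⟩ := h'
  exact ⟨τ.trans σ, by ext; simp⟩

namespace BanditAlgorithm

variable {M K d : ℕ} (π : BanditAlgorithm.{u} M K d)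

theorem disjoint_declares {c c' : Fin M → Fin K} (h : ¬ SameClustering c' c) :
    Disjoint (π.declares c) (π.declares c') := by
  rw [Set.disjoint_left]
  rintro ω ⟨t, ht, hc⟩ ⟨s, hs, hc'⟩
  rw [ht] at hs
  obtain rfl := Nat.cast_injective hs
  exact h (hc'.symm.trans hc)

theorem bernoulliKL_le_sum_expectedPulls [NeZero K] {δ : ℝ} (hδ : 0 < δ) (hδ' : δ ≤ 1 / 2)
    (hπ : π.IsPC δ) {μ ν : Fin M → EuclideanSpace ℝ (Fin d)} (hμ : IsInstance K μ)
    (hν : ν ∈ Alt K μ) :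
    bernoulliKL δ (1 - δ) ≤
      ∑ a, π.expectedPulls μ a * ENNReal.ofReal (‖ν a - μ a‖ ^ 2 / 2) := by
  rw [bernoulliKL_one_sub hδ (by linarith)]
  have hPC : ∀ ξ : Fin M → EuclideanSpace ℝ (Fin d), IsInstance K ξ →
      1 - δ ≤ (π.law ξ).real (π.declares (slinkIndex K ξ)) := fun ξ hξ =>
    (ENNReal.ofReal_le_iff_le_toReal (measure_ne_top _ _)).1 (hπ ξ hξ)
  refine π.ofReal_log_le_sum_expectedPulls μ ν _ hδ hδ' (hPC μ hμ) ?_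
  have h1 := measureReal_union (μ := π.law ν) (π.disjoint_declares hν.2)
    (π.measurableSet_declares _)
  have h2 : (π.law ν).real (π.declares (slinkIndex K μ) ∪ π.declares (slinkIndex K ν)) ≤ 1 :=
    measureReal_le_one
  linarith [hPC ν hν.1]

theorem bernoulliKL_mul_charTime_le [NeZero K] {δ : ℝ} (hδ : 0 < δ) (hδ' : δ ≤ 1 / 2)
    (hπ : π.IsPC δ) {μ : Fin M → EuclideanSpace ℝ (Fin d)} (hμ : IsInstance K μ) :
    bernoulliKL δ (1 - δ) * charTime K μ ≤ π.expectedSamples μ := by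
  have hkey := fun ν hν => π.bernoulliKL_le_sum_expectedPulls (ν := ν) hδ hδ' hπ hμ hν
  have hsum := π.sum_expectedPulls μ
  by_cases htop : π.expectedSamples μ = ∞
  · simp [htop]
  -- Pull proportions are undefined here. If alternatives exist, zero pulls force the divergence to
  -- vanish; otherwise the infimum is `∞` and `T*(μ) = 0`.
  by_cases hzero : π.expectedSamples μ = 0
  · rw [hzero, Finset.sum_eq_zero_iff] at hsum
    rcases (Alt K μ).eq_empty_or_nonempty with hE | ⟨ν, hν⟩
    -- Surjectivity onto `K ≥ 1` labels provides an arm; over an empty simplex the supremum would be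
    -- `0`.
    · obtain ⟨c, hc, -⟩ := hμ
      obtain ⟨m, -⟩ := hc 0
      have : (⨆ w ∈ stdSimplex ℝ (Fin M), ⨅ ν ∈ Alt K μ,
          ENNReal.ofReal ((1 / 2) * ∑ m, w m * ‖ν m - μ m‖ ^ 2)) = ∞ := by
        refine top_le_iff.1 (le_iSup₂_of_le _ (single_mem_stdSimplex ℝ m) ?_)
        simp [hE]
      rw [charTime, this, ENNReal.inv_top, mul_zero]
      exact zero_le
    · have h := hkey ν hν
      rw [Finset.sum_eq_zero fun a ha => by rw [hsum a ha, zero_mul]] at h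
      simp [le_zero_iff.1 h]
  have hTpos : 0 < (π.expectedSamples μ).toReal := ENNReal.toReal_pos hzero htop
  have hpulls : ∀ a, π.expectedPulls μ a ≠ ∞ := fun a h => htop <| top_le_iff.1 <| by
    rw [← hsum, ← h]
    exact Finset.single_le_sum (f := π.expectedPulls μ) (fun _ _ => zero_le) (Finset.mem_univ a)
  -- The expected pull proportions are one admissible `w`, the same for every `ν`.
  let w : Fin M → ℝ := fun a => (π.expectedPulls μ a).toReal / (π.expectedSamples μ).toReal
  have hw : w ∈ stdSimplex ℝ (Fin M) := by
    refine ⟨fun a => by positivity, ?_⟩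
    rw [← Finset.sum_div, ← ENNReal.toReal_sum fun a _ => hpulls a, hsum, div_self hTpos.ne']
  rw [charTime, ← div_eq_mul_inv]
  refine ENNReal.div_le_of_le_mul' ?_
  rw [← ENNReal.div_le_iff hzero htop]
  refine le_iSup₂_of_le w hw (le_iInf₂ fun ν hν => ?_)
  rw [ENNReal.div_le_iff hzero htop]
  refine (hkey ν hν).trans_eq ?_
  rw [← ENNReal.ofReal_toReal htop, ← ENNReal.ofReal_mul
    (mul_nonneg (by norm_num) (Finset.sum_nonneg fun a _ => mul_nonneg (hw.1 a) (by positivity)))]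
  have h : ∀ a, π.expectedPulls μ a * ENNReal.ofReal (‖ν a - μ a‖ ^ 2 / 2) =
      ENNReal.ofReal ((π.expectedPulls μ a).toReal * (‖ν a - μ a‖ ^ 2 / 2)) := fun a => by
    rw [ENNReal.ofReal_mul ENNReal.toReal_nonneg, ENNReal.ofReal_toReal (hpulls a)]
  simp_rw [h]
  rw [← ENNReal.ofReal_sum_of_nonneg fun a _ => by positivity]
  congr 1
  rw [Finset.mul_sum, Finset.sum_mul]
  refine Finset.sum_congr rfl fun a _ => ?_
  simp only [w]
  field_simp

end BanditAlgorithm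

theorem theorem1 (M K d : ℕ) [NeZero K] (μ : Fin M → EuclideanSpace ℝ (Fin d))
    (hμ : IsInstance K μ) :
    (∀ δ : ℝ, 0 < δ → δ ≤ 1 / 2 → ∀ π : BanditAlgorithm.{u} M K d, π.IsPC δ →
      bernoulliKL δ (1 - δ) * charTime K μ ≤ π.expectedSamples μ) ∧
    (∀ π : ℝ → BanditAlgorithm.{u} M K d,
      (∀ δ : ℝ, 0 < δ → δ ≤ 1 / 2 → (π δ).IsPC δ) →
      charTime K μ ≤
        liminf (fun δ : ℝ => (π δ).expectedSamples μ / ENNReal.ofReal (Real.log (1 / δ)))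
          (𝓝[>] 0)) := by
  refine ⟨fun δ hδ hδ' π hπ => π.bernoulliKL_mul_charTime_le hδ hδ' hπ hμ, fun π hπ => ?_⟩
  have hlim : Tendsto (fun δ : ℝ =>
      bernoulliKL δ (1 - δ) / ENNReal.ofReal (Real.log (1 / δ)) * charTime K μ) (𝓝[>] 0)
      (𝓝 (charTime K μ)) := by
    -- The limit `1` is nonzero, so the product converges even when `T*(μ) = ∞`.
    simpa using ENNReal.Tendsto.mul_const tendsto_bernoulliKL_div_log (.inl one_ne_zero)
  rw [← hlim.liminf_eq]
  refine liminf_le_liminf ?_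
  filter_upwards [Ioo_mem_nhdsGT (show (0 : ℝ) < 1 / 2 by norm_num)] with δ hδ
  rw [← ENNReal.mul_div_right_comm]
  exact ENNReal.div_le_div_right
    ((π δ).bernoulliKL_mul_charTime_le hδ.1 hδ.2.le (hπ δ hδ.1 hδ.2.le) hμ) _
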